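/- Let $\Gamma$ be a finite simple connected regular graph on $n$ vertices with adjacency matrix $A$, let $\lambda_0>\lambda_1>\dots>\lambda_d$ be the distinct eigenvalues of $A$, and put $\langle f,g\rangle=\frac1n\operatorname{tr}(f(A)g(A))$ for real polynomials $f,g$. The predistance polynomials of $\Gamma$ are the polynomials $p_0,\dots,p_d$ with $\deg p_i=i$ that are pairwise orthogonal with respect to $\langle\cdot,\cdot\rangle$ and satisfy $\langle p_i,p_i\rangle=p_i(\lambda_0)$; in addition let $p_{d+1}$ be the minimal polynomial $\prod_{l=0}^d(x-\lambda_l)$ of $A$. Let $\omega_i^j$ denote the coefficient of $x^j$ in $p_i$ ($0\le i\le d+1$). The girth of $\Gamma$ is the length of a shortest cycle (infinite if there is none). Then, for every integer $m\ge 0$: (a) $\Gamma$ has girth $2m+1$ if and only if $m\le d$, $\omega_i^j=0$ whenever $i\le m$ and $i+j$ is odd, $\omega_{m+1}^j\ne0$ for some $j$ with $m+1+j$ odd, and $\omega_1^1=\dots=\omega_m^m=1$. (b) $\Gamma$ has girth $2m$ if and only if $m\le d$, $\omega_i^j=0$ whenever $i\le m$ and $i+j$ is odd, $\omega_1^1=\dots=\omega_{m-1}^{m-1}=1$,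 and $\omega_m^m<1$. -/

import Mathlib

open Polynomial

noncomputable section

namespace Predistance

variable {V : Type*} [Fintype V] [DecidableEq V] (G : SimpleGraph V) [DecidableRel G.Adj]

/-- The number `d` of distinct adjacency eigenvalues, minus one. -/
def d : ℕ := (spectrum ℝ (G.adjMatrix ℝ)).ncard - 1

/-- The largest adjacency eigenvalue `lambda_0`. -/
def eigMax : ℝ := sSup (spectrum ℝ (G.adjMatrix ℝ))

/-- The scalar product `(1/n) tr (f(A) g(A))` on real polynomials, `A` the adjacency matrix. -/
def scalar (f g : ℝ[X]) : ℝ :=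
  (aeval (G.adjMatrix ℝ) f * aeval (G.adjMatrix ℝ) g).trace / Fintype.card V

/-- The monic orthogonal polynomials obtained from `1, X, X ^ 2, …` by the Gram-Schmidt method. -/
def monicOrtho (i : ℕ) : ℝ[X] :=
  X ^ i - ∑ j : Fin i,
    C (scalar G (X ^ i) (monicOrtho j) / scalar G (monicOrtho j) (monicOrtho j)) * monicOrtho j
termination_by i
decreasing_by all_goals exact j.2

/-- The predistance polynomial `p_i`, for `i ≤ d`: the multiple of the `i`-th monic orthogonal
polynomial whose squared norm is its value at the largest eigenvalue.
See `predist_spec` for the defining properties and `predist_unique` for uniqueness. -/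
def predist (i : ℕ) : ℝ[X] :=
  C ((monicOrtho G i).eval (eigMax G) / scalar G (monicOrtho G i) (monicOrtho G i)) *
    monicOrtho G i

/-- The coefficient `omega_i^j` of `x^j` in the predistance polynomial `p_i`, for `i ≤ d`.
The row `d + 1` holds the coefficients of the minimal polynomial of the adjacency matrix
(the next orthogonal polynomial, up to a factor). Only rows `i ≤ d + 1` are meaningful. -/
def omega (i j : ℕ) : ℝ :=
  if i ≤ d G then (predist G i).coeff j else (minpoly ℝ (G.adjMatrix ℝ)).coeff j

section spec

set_option linter.unusedSectionVars false

variable {G}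

lemma scalar_comm (f g : ℝ[X]) : scalar G f g = scalar G g f := by
  unfold scalar; rw [Matrix.trace_mul_comm]

lemma scalar_add_left (f g h : ℝ[X]) : scalar G (f + g) h = scalar G f h + scalar G g h := by
  simp [scalar, add_mul, add_div]

lemma scalar_sub_left (f g h : ℝ[X]) : scalar G (f - g) h = scalar G f h - scalar G g h := by
  simp [scalar, sub_mul, sub_div]

lemma scalar_C_mul_left (a : ℝ) (f h : ℝ[X]) : scalar G (C a * f) h = a * scalar G f h := by
  simp [scalar, Matrix.trace_smul, mul_div_assoc, Algebra.algebraMap_eq_smul_one]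

lemma scalar_C_mul_right (a : ℝ) (f h : ℝ[X]) : scalar G f (C a * h) = a * scalar G f h := by
  rw [scalar_comm, scalar_C_mul_left, scalar_comm]

lemma scalar_sum_left {ι : Type*} (s : Finset ι) (f : ι → ℝ[X]) (h : ℝ[X]) :
    scalar G (∑ i ∈ s, f i) h = ∑ i ∈ s, scalar G (f i) h := by
  simp [scalar, Finset.sum_mul, Matrix.trace_sum, Finset.sum_div]

lemma adj_herm : (G.adjMatrix ℝ).IsHermitian := by
  ext i j; simp [SimpleGraph.adjMatrix_apply, G.adj_comm]

lemma aeval_herm (f : ℝ[X]) : (aeval (G.adjMatrix ℝ) f).IsHermitian := by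
  have h : IsSelfAdjoint (G.adjMatrix ℝ) := adj_herm
  induction f using Polynomial.induction_on' with
  | add p q hp hq => rw [map_add]; exact hp.add hq
  | monomial n a =>
    rw [aeval_monomial, Algebra.algebraMap_eq_smul_one, smul_mul_assoc, one_mul]
    exact IsSelfAdjoint.smul (IsSelfAdjoint.all a) (h.pow n)

lemma scalar_self_nonneg (f : ℝ[X]) : 0 ≤ scalar G f f := by
  have h := (Matrix.posSemidef_conjTranspose_mul_self (aeval (G.adjMatrix ℝ) f)).trace_nonneg
  rw [(aeval_herm f).eq] at h
  unfold scalar; positivity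

variable [Nonempty V]

lemma aeval_eq_zero_of_scalar_self {f : ℝ[X]} (h : scalar G f f = 0) :
    aeval (G.adjMatrix ℝ) f = 0 := by
  have hn : (Fintype.card V : ℝ) ≠ 0 := by exact_mod_cast Fintype.card_ne_zero
  have h' : (aeval (G.adjMatrix ℝ) f * aeval (G.adjMatrix ℝ) f).trace = 0 := by
    simpa [scalar, hn] using h
  have h2 := (aeval_herm (G := G) f).eq
  rw [← Matrix.trace_conjTranspose_mul_self_eq_zero_iff, h2]; exact h'

lemma spectrum_finite : (spectrum ℝ (G.adjMatrix ℝ)).Finite :=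
  Matrix.finite_real_spectrum

lemma spectrum_nonempty : (spectrum ℝ (G.adjMatrix ℝ)).Nonempty := by
  obtain ⟨v⟩ := ‹Nonempty V›
  exact ⟨_, (adj_herm (G := G)).eigenvalues_mem_spectrum_real v⟩

lemma ncard_spectrum : (spectrum ℝ (G.adjMatrix ℝ)).ncard = d G + 1 := by
  have : (spectrum ℝ (G.adjMatrix ℝ)).ncard ≠ 0 := by
    rw [Ne, Set.ncard_eq_zero spectrum_finite]
    exact spectrum_nonempty.ne_empty
  unfold d; omega

lemma eq_zero_of_aeval {f : ℝ[X]} (hf : f.natDegree ≤ d G)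
    (h : aeval (G.adjMatrix ℝ) f = 0) : f = 0 := by
  by_contra h0
  have hsub : spectrum ℝ (G.adjMatrix ℝ) ⊆ (f.roots.toFinset : Set ℝ) := by
    intro x hx
    have h1 := spectrum.subset_polynomial_aeval (G.adjMatrix ℝ) f ⟨x, hx, rfl⟩
    rw [h, spectrum.zero_eq] at h1
    simpa [h0] using h1
  have h1 := Set.ncard_le_ncard hsub (Finset.finite_toSet _)
  rw [Set.ncard_coe_finset, ncard_spectrum] at h1
  have h2 := f.roots.toFinset_card_le
  have h3 := f.card_roots'
  omega

lemma scalar_self_pos {f : ℝ[X]} (hf : f.natDegree ≤ d G) (h0 : f ≠ 0) : 0 < scalar G f f :=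
  lt_of_le_of_ne (scalar_self_nonneg f) fun h =>
    h0 (eq_zero_of_aeval hf (aeval_eq_zero_of_scalar_self h.symm))

/-- A polynomial orthogonal to `q_0, …, q_{i-1}`, with `deg q_j = j`, is orthogonal to every
polynomial of degree less than `i`. -/
lemma scalar_eq_zero_of_degree_lt {g : ℝ[X]} {q : ℕ → ℝ[X]} {i : ℕ}
    (hdeg : ∀ j < i, (q j).degree = j) (horth : ∀ j < i, scalar G (q j) g = 0) :
    ∀ n ≤ i, ∀ f : ℝ[X], f.degree < n → scalar G f g = 0 := by
  intro n
  induction n with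
  | zero =>
    intro _ f hf
    have : f = 0 := by simpa [Polynomial.degree_eq_bot, Nat.WithBot.lt_zero_iff] using hf
    simp [this, scalar]
  | succ n ih =>
    intro hn f hf
    have hq := hdeg n (by omega)
    have hq0 : (q n).coeff n ≠ 0 := Polynomial.coeff_ne_zero_of_eq_degree hq
    have key : (f - C (f.coeff n / (q n).coeff n) * q n).degree < n := by
      rw [Polynomial.degree_lt_iff_coeff_zero] at hf ⊢
      intro m hm
      rw [coeff_sub, coeff_C_mul]
      rcases hm.eq_or_lt with rfl | hm
      · field_simp; ring
      · rw [hf m (by omega), Polynomial.coeff_eq_zero_of_degree_lt (show (q n).degree < (m : WithBot ℕ) by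
          rw [hq]; exact_mod_cast hm)]
        ring
    have h1 := ih (by omega) _ key
    rw [scalar_sub_left, scalar_C_mul_left, horth n (by omega)] at h1
    simpa using h1

lemma monicOrtho_sub_degree (i : ℕ) (h : ∀ j < i, (monicOrtho G j).degree = j) :
    (∑ j : Fin i, C (scalar G (X ^ i) (monicOrtho G j) /
      scalar G (monicOrtho G j) (monicOrtho G j)) * monicOrtho G j).degree < i := by
  rw [Polynomial.degree_lt_iff_coeff_zero]
  intro m hm
  rw [finsetSum_coeff]
  refine Finset.sum_eq_zero fun j _ => ?_
  rw [coeff_C_mul, Polynomial.coeff_eq_zero_of_degree_lt, mul_zero]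
  rw [h j j.2]; exact_mod_cast j.2.trans_le hm

lemma monicOrtho_degree (i : ℕ) : (monicOrtho G i).degree = i := by
  induction i using Nat.strong_induction_on with
  | _ i ih =>
    rw [monicOrtho, Polynomial.degree_sub_eq_left_of_degree_lt, degree_X_pow]
    rw [degree_X_pow]; exact monicOrtho_sub_degree i ih

lemma monicOrtho_monic (i : ℕ) : (monicOrtho G i).Monic := by
  rw [monicOrtho]
  exact (monic_X_pow i).sub_of_left (by
    rw [degree_X_pow]; exact monicOrtho_sub_degree i fun j _ => monicOrtho_degree j)

lemma monicOrtho_norm_pos {i : ℕ} (hi : i ≤ d G) :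
    0 < scalar G (monicOrtho G i) (monicOrtho G i) :=
  scalar_self_pos (by rw [natDegree_eq_of_degree_eq_some (monicOrtho_degree i)]; exact hi)
    (monicOrtho_monic i).ne_zero

lemma monicOrtho_orth {i : ℕ} (hi : i ≤ d G) :
    ∀ j < i, scalar G (monicOrtho G i) (monicOrtho G j) = 0 := by
  induction i using Nat.strong_induction_on with
  | _ i ih =>
    intro j hj
    have hjpos := monicOrtho_norm_pos (G := G) (i := j) (by omega)
    rw [monicOrtho, scalar_sub_left, scalar_sum_left, Finset.sum_eq_single (⟨j, hj⟩ : Fin i)]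
    · rw [scalar_C_mul_left, div_mul_cancel₀ _ hjpos.ne', sub_self]
    · intro b _ hb
      have hb' : (b : ℕ) ≠ j := fun h => hb (Fin.ext h)
      rw [scalar_C_mul_left]
      rcases lt_or_gt_of_ne hb' with h | h
      · rw [scalar_comm (monicOrtho G b) (monicOrtho G j), ih j hj (by omega) b h, mul_zero]
      · rw [ih b b.2 (by omega) j h, mul_zero]
    · simp

lemma monicOrtho_orth_lt {i : ℕ} (hi : i ≤ d G) {f : ℝ[X]} (hf : f.degree < i) :
    scalar G f (monicOrtho G i) = 0 :=
  scalar_eq_zero_of_degree_lt (q := monicOrtho G) (fun j _ => monicOrtho_degree j)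
    (fun j hj => by rw [scalar_comm]; exact monicOrtho_orth hi j hj) i le_rfl f hf

open scoped Pointwise in
lemma eigMax_sub_posSemidef :
    (eigMax G • (1 : Matrix V V ℝ) - G.adjMatrix ℝ).PosSemidef := by
  have hH : (eigMax G • (1 : Matrix V V ℝ) - G.adjMatrix ℝ).IsHermitian :=
    (Matrix.isHermitian_one.smul (IsSelfAdjoint.all _)).sub adj_herm
  rw [hH.posSemidef_iff_eigenvalues_nonneg]
  intro v
  have h1 := hH.eigenvalues_mem_spectrum_real v
  have h2 : spectrum ℝ (eigMax G • (1 : Matrix V V ℝ) - G.adjMatrix ℝ) =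
      ({eigMax G} : Set ℝ) - spectrum ℝ (G.adjMatrix ℝ) := by
    rw [← Algebra.algebraMap_eq_smul_one, spectrum.singleton_sub_eq]
  rw [h2] at h1
  obtain ⟨a, ha, b, hb, hab⟩ := h1
  rw [Set.mem_singleton_iff] at ha
  have : b ≤ eigMax G := le_csSup spectrum_finite.bddAbove hb
  simp only [Pi.zero_apply]
  simp only at hab
  linarith

open scoped Matrix in
lemma monicOrtho_eval_ne_zero {i : ℕ} (hi : i ≤ d G) :
    (monicOrtho G i).eval (eigMax G) ≠ 0 := by
  intro h
  obtain ⟨s, hs⟩ := Polynomial.dvd_iff_isRoot.2 h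
  have hm := (monicOrtho_monic (G := G) i).ne_zero
  have hs0 : s ≠ 0 := by rintro rfl; simp [hs] at hm
  have hdeg := monicOrtho_degree (G := G) i
  have hsi : s.degree < i := by
    rw [← hdeg, hs, degree_mul, degree_X_sub_C, degree_eq_natDegree hs0]
    norm_cast; omega
  have h1 := monicOrtho_orth_lt hi hsi
  set S := aeval (G.adjMatrix ℝ) s with hS
  set B := eigMax G • (1 : Matrix V V ℝ) - G.adjMatrix ℝ with hB
  have hBr : aeval (G.adjMatrix ℝ) (X - C (eigMax G)) = -B := by
    simp [hB, Algebra.algebraMap_eq_smul_one]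
  have hr : aeval (G.adjMatrix ℝ) (monicOrtho G i) = -(B * S) := by
    rw [hs, map_mul, hBr, neg_mul]
  have hn : (Fintype.card V : ℝ) ≠ 0 := by exact_mod_cast Fintype.card_ne_zero
  have hps : (S * B * S).PosSemidef := by
    have := (eigMax_sub_posSemidef (G := G)).conjTranspose_mul_mul_same S
    rwa [(aeval_herm s).eq] at this
  have htr : (S * B * S).trace = 0 := by
    rw [scalar, hr, div_eq_zero_iff, or_iff_left hn, mul_neg, Matrix.trace_neg, neg_eq_zero] at h1
    rw [mul_assoc]; exact h1
  have hz : S * B * S = 0 := hps.trace_eq_zero_iff.1 htr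
  have hBS : B * S = 0 := by
    refine Matrix.ext_of_mulVec_single fun v => ?_
    rw [← Matrix.mulVec_mulVec, Matrix.zero_mulVec,
      ← (eigMax_sub_posSemidef (G := G)).dotProduct_mulVec_zero_iff, star_trivial]
    have hST : Sᵀ = S := aeval_herm s
    have h3 : (S *ᵥ Pi.single v 1) ⬝ᵥ (B *ᵥ (S *ᵥ Pi.single v 1)) =
        (Pi.single v 1 : V → ℝ) ⬝ᵥ ((S * B * S) *ᵥ Pi.single v 1) := by
      have he (w : V → ℝ) : S *ᵥ w = w ᵥ* S := by rw [← Matrix.vecMul_transpose, hST]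
      nth_rewrite 1 [he]
      rw [← Matrix.dotProduct_mulVec, Matrix.mulVec_mulVec, Matrix.mulVec_mulVec, mul_assoc]
    rw [h3, hz]; simp
  exact hm (eq_zero_of_aeval (by rw [natDegree_eq_of_degree_eq_some hdeg]; exact hi)
    (by rw [hr, hBS, neg_zero]))

/-- The defining properties of the predistance polynomials. -/
theorem predist_spec :
    (∀ i ≤ d G, (predist G i).degree = i) ∧
    (∀ i ≤ d G, ∀ j ≤ d G, i ≠ j → scalar G (predist G i) (predist G j) = 0) ∧
    (∀ i ≤ d G, scalar G (predist G i) (predist G i) = (predist G i).eval (eigMax G)) := by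
  refine ⟨fun i hi => ?_, fun i hi j hj hij => ?_, fun i hi => ?_⟩
  · rw [predist, degree_C_mul, monicOrtho_degree]
    exact div_ne_zero (monicOrtho_eval_ne_zero hi) (monicOrtho_norm_pos hi).ne'
  · have : scalar G (monicOrtho G i) (monicOrtho G j) = 0 := by
      rcases lt_or_gt_of_ne hij with h | h
      · rw [scalar_comm]; exact monicOrtho_orth hj i h
      · exact monicOrtho_orth hi j h
    rw [predist, predist, scalar_C_mul_left, scalar_C_mul_right, this]
    simp
  · have := (monicOrtho_norm_pos (G := G) hi).ne'
    rw [predist, scalar_C_mul_left, scalar_C_mul_right, eval_mul, eval_C]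
    field_simp

/-- The defining properties determine the predistance polynomials. -/
theorem predist_unique (q : ℕ → ℝ[X]) (hdeg : ∀ i ≤ d G, (q i).degree = i)
    (horth : ∀ i ≤ d G, ∀ j ≤ d G, i ≠ j → scalar G (q i) (q j) = 0)
    (hnorm : ∀ i ≤ d G, scalar G (q i) (q i) = (q i).eval (eigMax G)) :
    ∀ i ≤ d G, q i = predist G i := by
  intro i hi
  have hpos := monicOrtho_norm_pos (G := G) hi
  set c := (q i).coeff i with hc
  have hc0 : c ≠ 0 := Polynomial.coeff_ne_zero_of_eq_degree (hdeg i hi)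
  have hlt : (q i - C c * monicOrtho G i).degree < i := by
    rw [Polynomial.degree_lt_iff_coeff_zero]
    intro m hm
    rw [coeff_sub, coeff_C_mul]
    rcases hm.eq_or_lt with rfl | hm
    · have := monicOrtho_monic (G := G) i
      rw [Monic, leadingCoeff, natDegree_eq_of_degree_eq_some (monicOrtho_degree i)] at this
      rw [this]; simp [hc]
    · rw [Polynomial.coeff_eq_zero_of_degree_lt (by rw [hdeg i hi]; exact_mod_cast hm),
        Polynomial.coeff_eq_zero_of_degree_lt (by rw [monicOrtho_degree]; exact_mod_cast hm)]
      simp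
  have h1 : scalar G (q i - C c * monicOrtho G i) (q i) = 0 :=
    scalar_eq_zero_of_degree_lt (q := q) (fun j hj => hdeg j (by omega))
      (fun j hj => horth j (by omega) i hi (by omega)) i le_rfl _ hlt
  have h2 := monicOrtho_orth_lt hi hlt
  have h3 : q i - C c * monicOrtho G i = 0 := by
    by_contra h0
    have := scalar_self_pos (G := G) (f := q i - C c * monicOrtho G i) (by
      have := (natDegree_lt_iff_degree_lt h0).2 hlt
      omega) h0
    rw [scalar_sub_left, scalar_C_mul_left, scalar_comm (q i), scalar_comm (monicOrtho G i), h1,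
      h2] at this
    simp at this
  have h4 : q i = C c * monicOrtho G i := sub_eq_zero.1 h3
  have h5 := hnorm i hi
  rw [h4, scalar_C_mul_left, scalar_C_mul_right, eval_mul, eval_C] at h5
  have h6 : c * scalar G (monicOrtho G i) (monicOrtho G i) = (monicOrtho G i).eval (eigMax G) :=
    mul_left_cancel₀ hc0 h5
  rw [h4, predist, ← h6, mul_div_cancel_right₀ _ hpos.ne']

end spec

end Predistance

end

/-!
Below the girth `Γ` looks like the `k`-regular tree. Let `T_0, T_1, …` be the distance polynomials
of that tree (`treePoly`); each is monic and has the parity of its degree. If the girth `g` is at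
least `2 i`, then `T_i(A)` is supported on the pairs of vertices at distance `i`, and its entry at
`(u, v)` is the number of neighbours of `v` closer to `u`, which is `1` if `2 i < g`
(`aeval_treePoly`, `branchMatrix_eq_distMatrix`). Hence the `T_i` with `2 i ≤ g` are pairwise
orthogonal, and the `i`-th monic orthogonal polynomial is `T_i` (`eq_treePoly`). This remains true
for `i = d + 1` and the minimal polynomial.

So the rows `i ≤ g / 2` have the required parity. The largest eigenvalue is `k`, so `ω_i^i = T_i(k)
/ ⟨T_i, T_i⟩` is the sum of the entries of `T_i(A)` over the sum of their squares. It is `1` if `2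
i < g`. If `2 i = g`, two antipodal vertices of a shortest cycle give an entry of at least `2`, so
`ω_i^i < 1` (`omega_self_lt_one`). If `g = 2 i + 1`, a shortest cycle has an edge whose ends are
both at distance `i` from the same vertex, so `⟨x T_i, T_i⟩ > 0`, which is incompatible with the
parity of row `i + 1` (`exists_omega_succ_ne_zero`). Thus the first row that deviates from the tree
determines the girth. That `d` is at least `g / 2` when the girth is finite (`le_d_of_le_egirth`)
holds because the minimal polynomial would otherwise be some `T_{d+1}` that does not vanish at `A`.
-/

open Polynomial

noncomputable section

/-! ### Distances and short cycles -/

namespace SimpleGraph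

variable {V : Type*} {G : SimpleGraph V}

/-- Two different paths with the same ends give a cycle no longer than their total length: the
subgraph formed by their edges has two paths between the same vertices, so it is not acyclic, and
a cycle in it uses every edge at most once. -/
lemma egirth_le_length_add_length {u v : V} {p q : G.Walk u v} (hp : p.IsPath) (hq : q.IsPath)
    (hpq : p ≠ q) : G.egirth ≤ ((p.length + q.length : ℕ) : ℕ∞) := by
  classical
  set s : Set (Sym2 V) := {e | e ∈ p.edges ∨ e ∈ q.edges} with hs
  set H : SimpleGraph V := fromEdgeSet s with hH
  have hHs : H.edgeSet ⊆ s := by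
    rw [hH, edgeSet_fromEdgeSet]; exact Set.sdiff_subset
  have hsG : ∀ e ∈ s, e ∈ G.edgeSet := by
    rintro e (he | he)
    · exact p.edges_subset_edgeSet he
    · exact q.edges_subset_edgeSet he
  have hsH : ∀ e ∈ s, e ∈ H.edgeSet := by
    intro e he
    rw [hH, edgeSet_fromEdgeSet]
    exact ⟨he, G.not_isDiag_of_mem_edgeSet (hsG e he)⟩
  have hpH : ∀ e ∈ p.edges, e ∈ H.edgeSet := fun e he => hsH e (Or.inl he)
  have hqH : ∀ e ∈ q.edges, e ∈ H.edgeSet := fun e he => hsH e (Or.inr he)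
  have hcyc : ¬ H.IsAcyclic := by
    intro hac
    have h := congrArg Subtype.val
      ((hac.subsingleton_path u v).elim ⟨p.transfer H hpH, hp.transfer hpH⟩
        ⟨q.transfer H hqH, hq.transfer hqH⟩)
    have hG : ∀ r : H.Walk u v, ∀ e ∈ r.edges, e ∈ G.edgeSet := fun r e he =>
      hsG e (hHs (r.edges_subset_edgeSet he))
    have h2 : (p.transfer H hpH).transfer G (hG _) = (q.transfer H hqH).transfer G (hG _) := by
      simp only at h
      congr 1
    rw [Walk.transfer_transfer, Walk.transfer_transfer, Walk.transfer_self,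
      Walk.transfer_self] at h2
    exact hpq h2
  rw [← egirth_eq_top] at hcyc
  obtain ⟨a, c, hc, -⟩ := exists_egirth_eq_length.2 (mt egirth_eq_top.2 hcyc)
  have hcG : ∀ e ∈ c.edges, e ∈ G.edgeSet := fun e he => hsG e (hHs (c.edges_subset_edgeSet he))
  refine (egirth_le_length (hc.transfer hcG)).trans ?_
  rw [Walk.length_transfer, Nat.cast_le, ← Walk.length_edges, ← Walk.length_edges,
    ← Walk.length_edges, ← List.length_append]
  refine (hc.edges_nodup.subperm fun e he => ?_).length_le
  simpa [hs] using hHs (c.edges_subset_edgeSet he)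

/-- Below the girth, a vertex at distance `i + 1` from `u` has only one neighbour closer to `u`:
two of them would give two geodesics. -/
lemma Connected.eq_of_adj_of_dist_eq (hG : G.Connected) {u v w w' : V} {i : ℕ}
    (hg : ((2 * (i + 1) : ℕ) : ℕ∞) < G.egirth) (hv : G.dist u v = i + 1)
    (hw : G.Adj w v) (hw' : G.Adj w' v) (hwi : G.dist u w = i) (hwi' : G.dist u w' = i) :
    w = w' := by
  obtain ⟨p, -, hp⟩ := hG.exists_path_of_dist u w
  obtain ⟨q, -, hq⟩ := hG.exists_path_of_dist u w'
  by_contra hne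
  have h := egirth_le_length_add_length
    ((p.concat hw).isPath_of_length_eq_dist (by rw [Walk.length_concat]; omega))
    ((q.concat hw').isPath_of_length_eq_dist (by rw [Walk.length_concat]; omega))
    (fun h => hne (by simpa using congrArg Walk.penultimate h))
  rw [Walk.length_concat, Walk.length_concat, hp, hq, hwi, hwi', ← two_mul] at h
  exact absurd h (not_le.2 hg)

/-- An edge between two vertices at distance `i` from `u` gives a walk of length `i + 1` to one
of them that is a path different from the geodesic. -/
lemma Connected.egirth_le_of_adj_of_dist_eq (hG : G.Connected) {u v w : V} {i : ℕ}
    (hv : G.dist u v = i) (hw : G.dist u w = i) (h : G.Adj w v) :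
    G.egirth ≤ ((2 * i + 1 : ℕ) : ℕ∞) := by
  classical
  obtain ⟨p, hpp, hp⟩ := hG.exists_path_of_dist u v
  obtain ⟨q, hqp, hq⟩ := hG.exists_path_of_dist u w
  have hvq : v ∉ q.support := by
    intro hvq
    have h1 := q.length_takeUntil_lt_length hvq h.ne'
    have h2 := dist_le (q.takeUntil v hvq)
    omega
  have h3 := egirth_le_length_add_length hpp (hqp.concat hvq h)
    (fun h => by have := congrArg Walk.length h; rw [Walk.length_concat] at this; omega)
  rw [Walk.length_concat] at h3
  convert h3 using 2
  omega

/-- The first half of a shortest cycle is a geodesic. -/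
lemma Walk.IsCycle.dist_getVert (hG : G.Connected) {u : V} {c : G.Walk u u} (hc : c.IsCycle)
    (hg : G.egirth = c.length) {j : ℕ} (hj : 2 * j ≤ c.length) :
    G.dist u (c.getVert j) = j := by
  have h3 := hc.three_le_length
  have hpath : (c.take j).IsPath := hc.isPath_take (by omega)
  have hlen : (c.take j).length = j := by rw [Walk.take_length]; omega
  obtain ⟨p, hpp, hp⟩ := hG.exists_path_of_dist u (c.getVert j)
  have hle := dist_le (c.take j)
  by_contra hne
  have h := egirth_le_length_add_length hpp hpath (fun h => hne (by rw [← hp, h, hlen]))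
  rw [hg, Nat.cast_le] at h
  omega

/-- The second half of a shortest cycle, read backwards, is a geodesic. -/
lemma Walk.IsCycle.dist_getVert_of_le (hG : G.Connected) {u : V} {c : G.Walk u u} (hc : c.IsCycle)
    (hg : G.egirth = c.length) {j l : ℕ} (hjl : j + l = c.length) (hj : 2 * j ≤ c.length) :
    G.dist u (c.getVert l) = j := by
  have h := hc.reverse.dist_getVert hG (by simpa using hg) (j := j) (by simpa using hj)
  rwa [Walk.getVert_reverse, show c.length - j = l by omega] at h

lemma Connected.dist_le_succ_of_adj (hG : G.Connected) (u : V) {v w : V} (h : G.Adj v w) :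
    G.dist u w ≤ G.dist u v + 1 := by
  have h1 := hG.dist_triangle (u := u) (v := v) (w := w)
  rwa [dist_eq_one_iff_adj.2 h] at h1

lemma Connected.exists_adj_dist_eq (hG : G.Connected) {u v : V} {i : ℕ} (h : G.dist u v = i + 1) :
    ∃ w, G.Adj v w ∧ G.dist u w = i := by
  obtain ⟨p, hp⟩ := hG.exists_walk_length_eq_dist u v
  have hnil : ¬ p.Nil := by
    rw [Walk.not_nil_iff_lt_length]; omega
  refine ⟨p.penultimate, (p.adj_penultimate hnil).symm, ?_⟩
  have h1 := dist_le p.dropLast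
  have h2 := hG.dist_le_succ_of_adj u (p.adj_penultimate hnil)
  have h3 : p.dropLast.length + 1 = p.length := Walk.length_dropLast_add_one hnil
  omega

section count

variable [Fintype V] [DecidableRel G.Adj]

variable (G) in
/-- The number of neighbours of `v` at distance `i` from `u`. -/
def nbrsAtDist (u v : V) (i : ℕ) : ℕ := ((G.neighborFinset v).filter fun w => G.dist u w = i).card

lemma nbrsAtDist_pos_iff {u v : V} {i : ℕ} :
    0 < G.nbrsAtDist u v i ↔ ∃ w, G.Adj v w ∧ G.dist u w = i := by
  simp [nbrsAtDist, Finset.card_pos, Finset.Nonempty]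

lemma Connected.nbrsAtDist_eq_zero (hG : G.Connected) {u v : V} {i : ℕ}
    (h : G.dist u v + 1 < i ∨ i + 1 < G.dist u v) : G.nbrsAtDist u v i = 0 := by
  by_contra h0
  obtain ⟨w, hw, rfl⟩ := nbrsAtDist_pos_iff.1 (Nat.pos_of_ne_zero h0)
  have h1 := hG.dist_le_succ_of_adj u hw
  have h2 := hG.dist_le_succ_of_adj u hw.symm
  omega

lemma Connected.nbrsAtDist_self_eq_zero (hG : G.Connected) {u v : V} {i : ℕ}
    (hg : ((2 * i + 1 : ℕ) : ℕ∞) < G.egirth) (h : G.dist u v = i) : G.nbrsAtDist u v i = 0 := by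
  by_contra h0
  obtain ⟨w, hw, hwi⟩ := nbrsAtDist_pos_iff.1 (Nat.pos_of_ne_zero h0)
  exact absurd (hG.egirth_le_of_adj_of_dist_eq h hwi hw.symm) (not_le.2 hg)

lemma Connected.nbrsAtDist_pred_eq_one (hG : G.Connected) {u v : V} {i : ℕ}
    (hg : ((2 * (i + 1) : ℕ) : ℕ∞) < G.egirth) (h : G.dist u v = i + 1) :
    G.nbrsAtDist u v i = 1 := by
  obtain ⟨w, hw, hwi⟩ := hG.exists_adj_dist_eq h
  rw [nbrsAtDist, Finset.card_eq_one]
  refine ⟨w, Finset.eq_singleton_iff_unique_mem.2 ⟨by simp [hw, hwi], fun x hx => ?_⟩⟩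
  rw [Finset.mem_filter, mem_neighborFinset] at hx
  exact hG.eq_of_adj_of_dist_eq hg h hx.1.symm hw.symm hx.2 hwi

lemma nbrsAtDist_self_one (u : V) : G.nbrsAtDist u u 1 = G.degree u := by
  rw [nbrsAtDist, Finset.filter_true_of_mem, card_neighborFinset_eq_degree]
  intro w hw
  exact dist_eq_one_iff_adj.2 ((mem_neighborFinset _ _ _).1 hw)

lemma Connected.nbrsAtDist_succ_add_one (hG : G.Connected) {u v : V} {i : ℕ}
    (hg : ((2 * (i + 1) + 1 : ℕ) : ℕ∞) < G.egirth) (h : G.dist u v = i + 1) :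
    G.nbrsAtDist u v (i + 2) + 1 = G.degree v := by
  classical
  have h1 := hG.nbrsAtDist_pred_eq_one (lt_of_le_of_lt (Nat.cast_le.2 (Nat.le_succ _)) hg) h
  have h0 := hG.nbrsAtDist_self_eq_zero hg h
  rw [← card_neighborFinset_eq_degree, ← h1, nbrsAtDist, nbrsAtDist,
    ← Finset.card_filter_add_card_filter_not (s := G.neighborFinset v)
      (fun w => G.dist u w = i + 2)]
  congr 2
  refine Finset.filter_congr fun w hw => ?_
  rw [mem_neighborFinset] at hw
  have h2 := hG.dist_le_succ_of_adj u hw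
  have h3 := hG.dist_le_succ_of_adj u hw.symm
  have h4 : G.dist u w ≠ i + 1 := fun h5 =>
    absurd (nbrsAtDist_pos_iff.2 ⟨w, hw, h5⟩) (by omega)
  omega

end count

end SimpleGraph

/-! ### The polynomials of the regular tree -/

namespace Predistance

/-- The distance polynomials of the `k`-regular tree: `T_0 = 1`, `T_1 = x`, `T_2 = x ^ 2 - k` and
`T_{i+1} = x T_i - (k - 1) T_{i-1}` for `i ≥ 2`. -/
def treePoly (k : ℝ) : ℕ → ℝ[X]
  | 0 => 1
  | 1 => X
  | 2 => X ^ 2 - C k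
  | i + 3 => X * treePoly k (i + 2) - C (k - 1) * treePoly k (i + 1)

/-- The recursion in uniform shape; the root of the tree has `k` children, every other vertex
`k - 1`. -/
lemma treePoly_add_two (k : ℝ) (i : ℕ) :
    treePoly k (i + 2) =
      X * treePoly k (i + 1) - C (if i = 0 then k else k - 1) * treePoly k i := by
  rcases i with _ | i
  · simp [treePoly, sq]
  · simp [treePoly]

lemma treePoly_coeff_of_odd (k : ℝ) (i : ℕ) :
    ∀ j, Odd (i + j) → (treePoly k i).coeff j = 0 := by
  induction i using Nat.twoStepInduction with
  | zero =>
    intro j hj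
    rw [treePoly, coeff_one, if_neg]
    rintro rfl
    simp at hj
  | one =>
    intro j hj
    rw [treePoly, coeff_X, if_neg]
    rintro rfl
    revert hj; decide
  | more i ih0 ih1 =>
    intro j hj
    have h0 : Odd (i + j) := by
      rw [Nat.odd_iff] at hj ⊢; omega
    rw [treePoly_add_two, coeff_sub, coeff_C_mul, ih0 j h0, mul_zero, sub_zero]
    rcases j with _ | j
    · simp
    · rw [coeff_X_mul]
      apply ih1
      rw [Nat.odd_iff] at hj ⊢; omega

lemma treePoly_monic_and_natDegree (k : ℝ) (i : ℕ) :
    (treePoly k i).Monic ∧ (treePoly k i).natDegree = i := by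
  induction i using Nat.twoStepInduction with
  | zero => exact ⟨monic_one, natDegree_one⟩
  | one => exact ⟨monic_X, natDegree_X⟩
  | more i ih0 ih1 =>
    rw [treePoly_add_two]
    have hm : (X * treePoly k (i + 1)).Monic := monic_X.mul ih1.1
    have hd : (X * treePoly k (i + 1)).natDegree = i + 2 := by
      rw [natDegree_X_mul ih1.1.ne_zero, ih1.2]
    have hlt : (C (if i = 0 then k else k - 1) * treePoly k i).natDegree <
        (X * treePoly k (i + 1)).natDegree := by
      rw [hd]
      exact (natDegree_C_mul_le _ _).trans_lt (by omega)
    refine ⟨hm.sub_of_left (degree_lt_degree hlt), ?_⟩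
    rw [natDegree_sub_eq_left_of_natDegree_lt hlt, hd]

lemma treePoly_monic (k : ℝ) (i : ℕ) : (treePoly k i).Monic := (treePoly_monic_and_natDegree k i).1

lemma treePoly_natDegree (k : ℝ) (i : ℕ) : (treePoly k i).natDegree = i :=
  (treePoly_monic_and_natDegree k i).2

lemma treePoly_degree (k : ℝ) (i : ℕ) : (treePoly k i).degree = i := by
  rw [degree_eq_natDegree (treePoly_monic k i).ne_zero, treePoly_natDegree]

/-! ### Tree polynomials of the adjacency matrix -/

variable {V : Type*} [Fintype V] {G : SimpleGraph V} [DecidableRel G.Adj]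

variable (G) in
/-- The `i`-th distance matrix, with entry `1` at the pairs of vertices at distance `i`. -/
def distMatrix (i : ℕ) : Matrix V V ℝ := Matrix.of fun u v => if G.dist u v = i then 1 else 0

lemma distMatrix_mul_adjMatrix_apply (i : ℕ) (u v : V) :
    (distMatrix G i * G.adjMatrix ℝ) u v = G.nbrsAtDist u v i := by
  rw [SimpleGraph.mul_adjMatrix_apply]
  simp [distMatrix, SimpleGraph.nbrsAtDist]

variable [DecidableEq V]

variable (G) in
/-- The `i`-th distance matrix with each entry weighted by the number of neighbours of `v` one step
closer to `u`, that is, by the number of possible last steps of a geodesic from `u` to `v`. At `i =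
0`, where there is no last step, it is the identity matrix. -/
def branchMatrix : ℕ → Matrix V V ℝ
  | 0 => 1
  | i + 1 => Matrix.of fun u v => if G.dist u v = i + 1 then (G.nbrsAtDist u v i : ℝ) else 0

lemma branchMatrix_eq_distMatrix (hG : G.Connected) {i : ℕ}
    (hg : ((2 * i : ℕ) : ℕ∞) < G.egirth) : branchMatrix G i = distMatrix G i := by
  ext u v
  rcases i with _ | i
  · simp [branchMatrix, distMatrix, Matrix.one_apply, hG.dist_eq_zero_iff]
  · simp only [branchMatrix, distMatrix, Matrix.of_apply]
    split_ifs with h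
    · rw [hG.nbrsAtDist_pred_eq_one hg h, Nat.cast_one]
    · rfl

/-- The three-term recursion. A vertex `v` at distance `i` from `u` has no neighbour at that
distance, and all its neighbours but the one closer to `u` (if `v ≠ u`) are at distance `i + 1`. -/
lemma branchMatrix_succ (hG : G.Connected) {k : ℕ} (hreg : G.IsRegularOfDegree k) {i : ℕ}
    (hg : ((2 * (i + 2) : ℕ) : ℕ∞) ≤ G.egirth) :
    branchMatrix G (i + 2) = distMatrix G (i + 1) * G.adjMatrix ℝ -
      (if i = 0 then (k : ℝ) else k - 1) • distMatrix G i := by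
  ext u v
  rw [Matrix.sub_apply, distMatrix_mul_adjMatrix_apply, Matrix.smul_apply]
  simp only [branchMatrix, distMatrix, Matrix.of_apply, smul_eq_mul]
  have hlt (a : ℕ) (ha : a < 2 * (i + 2)) : (a : ℕ∞) < G.egirth :=
    lt_of_lt_of_le (Nat.cast_lt.2 ha) hg
  have hcases : G.dist u v = i + 2 ∨ G.dist u v = i + 1 ∨ G.dist u v = i ∨
      (G.dist u v + 1 < i + 1 ∨ i + 1 + 1 < G.dist u v) := by omega
  rcases hcases with h | h | h | h
  · simp [h]
  · simp [h, hG.nbrsAtDist_self_eq_zero (hlt (2 * (i + 1) + 1) (by omega)) h]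
  · rcases i with _ | i
    · rw [hG.dist_eq_zero_iff] at h
      subst h
      simp [SimpleGraph.nbrsAtDist_self_one, hreg u]
    · have h1 := hG.nbrsAtDist_succ_add_one (hlt (2 * (i + 1) + 1) (by omega)) h
      rw [hreg v] at h1
      simp [h, ← h1]
  · rw [hG.nbrsAtDist_eq_zero h, if_neg (show G.dist u v ≠ i by omega)]
    simp

/-- Up to half the girth, the tree polynomial `T_i` takes `A` to the weighted distance matrix. -/
lemma aeval_treePoly (hG : G.Connected) {k : ℕ} (hreg : G.IsRegularOfDegree k) (i : ℕ) :
    ((2 * i : ℕ) : ℕ∞) ≤ G.egirth →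
    aeval (G.adjMatrix ℝ) (treePoly k i) = branchMatrix G i := by
  induction i using Nat.twoStepInduction with
  | zero => intro _; simp [treePoly, branchMatrix]
  | one =>
    intro _
    ext u v
    simp only [treePoly, aeval_X, branchMatrix, Matrix.of_apply, SimpleGraph.adjMatrix_apply,
      zero_add, SimpleGraph.dist_eq_one_iff_adj]
    split_ifs with h
    · rw [hG.nbrsAtDist_pred_eq_one
        (lt_of_lt_of_le (by norm_num) SimpleGraph.three_le_egirth)
        (SimpleGraph.dist_eq_one_iff_adj.2 h), Nat.cast_one]
    · rfl
  | more i ih0 ih1 =>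
    intro hg
    have h0 : ((2 * i : ℕ) : ℕ∞) < G.egirth := lt_of_lt_of_le (Nat.cast_lt.2 (by omega)) hg
    have h1 : ((2 * (i + 1) : ℕ) : ℕ∞) < G.egirth := lt_of_lt_of_le (Nat.cast_lt.2 (by omega)) hg
    rw [treePoly_add_two, mul_comm X, map_sub, map_mul, map_mul, aeval_X, aeval_C, ih0 h0.le,
      ih1 h1.le, branchMatrix_eq_distMatrix hG h0, branchMatrix_eq_distMatrix hG h1,
      branchMatrix_succ hG hreg hg, Algebra.algebraMap_eq_smul_one, smul_mul_assoc, one_mul]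

lemma branchMatrix_apply_of_dist_ne {i : ℕ} {u v : V} (h : G.dist u v ≠ i) :
    branchMatrix G i u v = 0 := by
  rcases i with _ | i
  · rw [branchMatrix, Matrix.one_apply, if_neg]
    rintro rfl
    simp at h
  · simp [branchMatrix, h]

lemma exists_natCast_eq_branchMatrix_apply (i : ℕ) (u v : V) :
    ∃ a : ℕ, branchMatrix G i u v = a := by
  rcases i with _ | i
  · exact ⟨if u = v then 1 else 0, by simp [branchMatrix, Matrix.one_apply]⟩
  · exact ⟨if G.dist u v = i + 1 then G.nbrsAtDist u v i else 0, by simp [branchMatrix]⟩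

lemma branchMatrix_apply_pos (hG : G.Connected) {i : ℕ} {u v : V} (h : G.dist u v = i) :
    0 < branchMatrix G i u v := by
  rcases i with _ | i
  · rw [hG.dist_eq_zero_iff] at h
    subst h
    simp [branchMatrix]
  · simpa [branchMatrix, h, SimpleGraph.nbrsAtDist_pos_iff] using hG.exists_adj_dist_eq h

/-! ### The scalar product, the largest eigenvalue and the minimal polynomial -/

lemma scalar_eq_sum (f g : ℝ[X]) :
    scalar G f g = (∑ u, ∑ v, aeval (G.adjMatrix ℝ) f u v * aeval (G.adjMatrix ℝ) g u v) /
      Fintype.card V := by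
  rw [scalar]
  congr 1
  conv_lhs => rw [← (aeval_herm g).eq]
  simp [Matrix.trace, Matrix.mul_apply]

lemma aeval_row_sum {k : ℕ} (hreg : G.IsRegularOfDegree k) (f : ℝ[X]) (u : V) :
    ∑ v, aeval (G.adjMatrix ℝ) f u v = f.eval (k : ℝ) := by
  have key : ∀ u, (∑ v, aeval (G.adjMatrix ℝ) f u v) = f.eval (k : ℝ) := by
    induction f using Polynomial.induction_on with
    | C a => intro u; simp [Algebra.algebraMap_eq_smul_one, Matrix.one_apply]
    | add p q hp hq => intro u; simp [Finset.sum_add_distrib, hp, hq]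
    | monomial n a ih =>
      intro u
      have h : aeval (G.adjMatrix ℝ) (C a * X ^ (n + 1)) =
          G.adjMatrix ℝ * aeval (G.adjMatrix ℝ) (C a * X ^ n) := by
        rw [show C a * X ^ (n + 1) = X * (C a * X ^ n) by ring, map_mul, aeval_X]
      rw [h]
      simp only [SimpleGraph.adjMatrix_mul_apply]
      rw [Finset.sum_comm]
      simp only [ih, Finset.sum_const, SimpleGraph.card_neighborFinset_eq_degree, hreg u]
      simp only [nsmul_eq_mul, eval_mul, eval_C, eval_pow, eval_X]
      ring
  exact key u

lemma sum_aeval [Nonempty V] {k : ℕ} (hreg : G.IsRegularOfDegree k) (f : ℝ[X]) :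
    f.eval (k : ℝ) = (∑ u, ∑ v, aeval (G.adjMatrix ℝ) f u v) / Fintype.card V := by
  have hn : (Fintype.card V : ℝ) ≠ 0 := by exact_mod_cast Fintype.card_ne_zero
  simp only [aeval_row_sum hreg, Finset.sum_const, Finset.card_univ, nsmul_eq_mul]
  field_simp

lemma eigMax_eq [Nonempty V] {k : ℕ} (hreg : G.IsRegularOfDegree k) : eigMax G = k := by
  have hmem : (k : ℝ) ∈ spectrum ℝ (G.adjMatrix ℝ) := by
    rw [← Matrix.spectrum_toLin', ← Module.End.hasEigenvalue_iff_mem_spectrum]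
    refine Module.End.hasEigenvalue_of_hasEigenvector (x := fun _ => (1 : ℝ)) ⟨?_, ?_⟩
    · rw [Module.End.mem_eigenspace_iff]
      ext v
      simpa using SimpleGraph.adjMatrix_mulVec_const_apply_of_regular (a := (1 : ℝ)) (v := v) hreg
    · intro h
      obtain ⟨v⟩ := ‹Nonempty V›
      simpa using congrFun h v
  refine le_antisymm (csSup_le ⟨_, hmem⟩ fun x hx => ?_) (le_csSup spectrum_finite.bddAbove hmem)
  -- The Laplacian `k - A` is positive semidefinite, so no eigenvalue of `A` exceeds `k`.
  have hlap : G.lapMatrix ℝ = algebraMap ℝ (Matrix V V ℝ) k - G.adjMatrix ℝ := by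
    rw [SimpleGraph.lapMatrix, SimpleGraph.degMatrix]
    congr 1
    ext u v
    simp [hreg _, Matrix.diagonal_apply, Matrix.algebraMap_matrix_apply]
  have hps := SimpleGraph.posSemidef_lapMatrix ℝ G
  have h1 : (k : ℝ) - x ∈ spectrum ℝ (G.lapMatrix ℝ) := by
    rw [hlap, ← spectrum.singleton_sub_eq]
    exact Set.sub_mem_sub rfl hx
  have h2 : (0 : ℝ) ≤ k - x := (Matrix.posSemidef_iff_isHermitian_and_spectrum_nonneg.1 hps).2 h1
  linarith

variable (G) in
/-- A power of the product vanishes at `A` by Cayley-Hamilton, and a symmetric nilpotent matrix is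
zero. -/
lemma aeval_prod_spectrum [Nonempty V] : aeval (G.adjMatrix ℝ)
    (∏ x ∈ (spectrum_finite (G := G)).toFinset, (X - C x)) = 0 := by
  set f : ℝ[X] := ∏ x ∈ (spectrum_finite (G := G)).toFinset, (X - C x) with hf
  have hdvd : (G.adjMatrix ℝ).charpoly ∣ f ^ Fintype.card V := by
    rw [(adj_herm (G := G)).charpoly_eq, ← Finset.card_univ, ← Finset.prod_const]
    refine Finset.prod_dvd_prod_of_dvd _ _ fun v _ => ?_
    exact Finset.dvd_prod_of_mem (fun x => X - C x)
      (by simpa using (adj_herm (G := G)).eigenvalues_mem_spectrum_real v)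
  have hpow : aeval (G.adjMatrix ℝ) f ^ Fintype.card V = 0 := by
    obtain ⟨q, hq⟩ := hdvd
    rw [← map_pow, hq, map_mul, Matrix.aeval_self_charpoly, zero_mul]
  have hB := aeval_herm (G := G) f
  rw [← hB.eigenvalues_eq_zero_iff]
  ext v
  have h := spectrum.pow_mem_pow (aeval (G.adjMatrix ℝ) f) (Fintype.card V)
    (hB.eigenvalues_mem_spectrum_real v)
  rw [hpow, spectrum.zero_eq] at h
  exact eq_zero_of_pow_eq_zero h

variable (G) in
lemma minpoly_natDegree [Nonempty V] : (minpoly ℝ (G.adjMatrix ℝ)).natDegree = d G + 1 := by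
  have hint : IsIntegral ℝ (G.adjMatrix ℝ) := Algebra.IsIntegral.isIntegral _
  have hm : (∏ x ∈ (spectrum_finite (G := G)).toFinset, (X - C x)).Monic :=
    monic_prod_of_monic _ _ fun x _ => monic_X_sub_C x
  apply le_antisymm
  · have h := natDegree_le_of_dvd (minpoly.dvd ℝ _ (aeval_prod_spectrum G)) hm.ne_zero
    rwa [natDegree_finsetProd_X_sub_C_eq_card _ (fun x => x),
      ← Set.ncard_eq_toFinset_card _ spectrum_finite, ncard_spectrum] at h
  · by_contra h
    exact minpoly.ne_zero hint (eq_zero_of_aeval (G := G)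
      (Nat.lt_succ_iff.1 (not_le.1 h)) (minpoly.aeval ℝ _))

/-! ### Orthogonality of the tree polynomials -/

section treePoly

variable {k : ℕ}

/-- The values at `A` are supported on pairs of vertices at different distances. -/
lemma scalar_treePoly_eq_zero (hG : G.Connected) (hreg : G.IsRegularOfDegree k) {i j : ℕ}
    (hij : i ≠ j) (hi : ((2 * i : ℕ) : ℕ∞) ≤ G.egirth) (hj : ((2 * j : ℕ) : ℕ∞) ≤ G.egirth) :
    scalar G (treePoly k i) (treePoly k j) = 0 := by
  rw [scalar_eq_sum, aeval_treePoly hG hreg i hi, aeval_treePoly hG hreg j hj]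
  rw [Finset.sum_eq_zero, zero_div]
  refine fun u _ => Finset.sum_eq_zero fun v _ => ?_
  by_cases h : G.dist u v = i
  · rw [branchMatrix_apply_of_dist_ne (i := j) (by omega), mul_zero]
  · rw [branchMatrix_apply_of_dist_ne h, zero_mul]

lemma scalar_treePoly_eq_zero_of_degree_lt [Nonempty V] (hG : G.Connected)
    (hreg : G.IsRegularOfDegree k) {i : ℕ}
    (hi : ((2 * i : ℕ) : ℕ∞) ≤ G.egirth) {f : ℝ[X]} (hf : f.degree < i) :
    scalar G f (treePoly k i) = 0 :=
  scalar_eq_zero_of_degree_lt (q := treePoly k) (fun j _ => treePoly_degree k j)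
    (fun j hj => scalar_treePoly_eq_zero hG hreg hj.ne
      ((Nat.cast_le.2 (by omega)).trans hi) hi) i le_rfl f hf

/-- Up to half the girth, the monic orthogonal polynomials are the tree polynomials. The case
`i = d + 1`, where the scalar product no longer separates polynomials of degree `i`, still holds
because a difference of two monic polynomials has degree at most `d`; it applies to the minimal
polynomial. -/
lemma eq_treePoly [Nonempty V] (hG : G.Connected) (hreg : G.IsRegularOfDegree k) {i : ℕ}
    (hid : i ≤ d G + 1) (hi : ((2 * i : ℕ) : ℕ∞) ≤ G.egirth) {q : ℝ[X]} (hq : q.Monic)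
    (hdeg : q.degree = i) (horth : ∀ f : ℝ[X], f.degree < i → scalar G f q = 0) :
    q = treePoly k i := by
  have hlt : (q - treePoly k i).degree < i := by
    rw [← hdeg]
    exact degree_sub_lt_left (by rw [hdeg, treePoly_degree]) hq.ne_zero
      (hq.leadingCoeff.trans (treePoly_monic k i).leadingCoeff.symm)
  by_contra hne
  have h0 : q - treePoly k i ≠ 0 := sub_ne_zero.2 hne
  have hpos := scalar_self_pos (G := G) (f := q - treePoly k i) (by
    have := (natDegree_lt_iff_degree_lt h0).2 hlt
    omega) h0
  rw [scalar_sub_left, scalar_comm q, scalar_comm (treePoly k i), horth _ hlt,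
    scalar_treePoly_eq_zero_of_degree_lt hG hreg hi hlt, sub_self] at hpos
  exact lt_irrefl _ hpos

/-- Both sides average the row sums of `T_i(A)`, whose entries are `0` or `1`. -/
lemma scalar_treePoly_self_eq [Nonempty V] (hG : G.Connected) (hreg : G.IsRegularOfDegree k)
    {i : ℕ} (hi : ((2 * i : ℕ) : ℕ∞) < G.egirth) :
    scalar G (treePoly k i) (treePoly k i) = (treePoly k i).eval (k : ℝ) := by
  rw [scalar_eq_sum, sum_aeval hreg, aeval_treePoly hG hreg i hi.le,
    branchMatrix_eq_distMatrix hG hi]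
  congr! 4 with u _ v _
  simp [distMatrix]

/-- The entries of `T_i(A)` are natural numbers, and the one at two antipodal vertices of a shortest
cycle is at least `2`, so the sum of their squares exceeds their sum. -/
lemma eval_treePoly_lt_scalar_self [Nonempty V] (hG : G.Connected)
    (hreg : G.IsRegularOfDegree k) {i : ℕ} (hi : G.egirth = ((2 * i : ℕ) : ℕ∞)) :
    (treePoly k i).eval (k : ℝ) < scalar G (treePoly k i) (treePoly k i) := by
  rw [scalar_eq_sum, sum_aeval hreg, aeval_treePoly hG hreg i hi.ge]
  have hn : (0 : ℝ) < Fintype.card V := by exact_mod_cast Fintype.card_pos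
  obtain ⟨u, c, hc, hcl⟩ := SimpleGraph.exists_egirth_eq_length.2 (mt SimpleGraph.egirth_eq_top.2
    (by rw [hi]; exact ENat.natCast_ne_top _))
  have hlen : c.length = 2 * i := by
    rw [hi, Nat.cast_inj] at hcl; exact hcl.symm
  have h3 := hc.three_le_length
  obtain ⟨l, rfl⟩ : ∃ l, i = l + 1 := ⟨i - 1, by omega⟩
  have hd : G.dist u (c.getVert (l + 1)) = l + 1 := hc.dist_getVert hG hcl (by omega)
  have hbig : 1 < branchMatrix G (l + 1) u (c.getVert (l + 1)) := by
    simp only [branchMatrix, Matrix.of_apply, hd, if_true]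
    rw [Nat.one_lt_cast, SimpleGraph.nbrsAtDist, Finset.one_lt_card]
    refine ⟨c.getVert l, ?_, c.getVert (l + 2), ?_, fun h => ?_⟩
    · rw [Finset.mem_filter, SimpleGraph.mem_neighborFinset]
      exact ⟨(c.adj_getVert_succ (by omega)).symm, hc.dist_getVert hG hcl (by omega)⟩
    · rw [Finset.mem_filter, SimpleGraph.mem_neighborFinset]
      exact ⟨c.adj_getVert_succ (by omega),
        hc.dist_getVert_of_le hG hcl (by omega) (by omega)⟩
    · have := hc.getVert_injOn (x₁ := l) (x₂ := l + 2) (by simp; omega) (by simp; omega) h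
      omega
  have hle (u v : V) : branchMatrix G (l + 1) u v ≤
      branchMatrix G (l + 1) u v * branchMatrix G (l + 1) u v := by
    obtain ⟨a, ha⟩ := exists_natCast_eq_branchMatrix_apply (G := G) (l + 1) u v
    rw [ha]
    exact_mod_cast Nat.le_mul_self a
  gcongr ?_ / _
  refine Finset.sum_lt_sum (fun u _ => Finset.sum_le_sum fun v _ => hle u v)
    ⟨u, Finset.mem_univ _, Finset.sum_lt_sum (fun v _ => hle u v)
      ⟨c.getVert (l + 1), Finset.mem_univ _, ?_⟩⟩
  exact lt_mul_of_one_lt_left (by linarith) hbig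

/-- Up to the factor `1 / n`, this scalar product counts the pairs of a vertex and an oriented edge
whose two ends are both at distance `m` from it. The edge of a shortest cycle of length `2 m + 1`
opposite to a vertex gives such a pair. -/
lemma scalar_X_mul_treePoly_pos [Nonempty V] (hG : G.Connected) (hreg : G.IsRegularOfDegree k)
    {m : ℕ} (hm : G.egirth = ((2 * m + 1 : ℕ) : ℕ∞)) :
    0 < scalar G (treePoly k m * X) (treePoly k m) := by
  have hlt : ((2 * m : ℕ) : ℕ∞) < G.egirth := by rw [hm, Nat.cast_lt]; omega
  rw [scalar_eq_sum, map_mul, aeval_X, aeval_treePoly hG hreg m hlt.le,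
    branchMatrix_eq_distMatrix hG hlt]
  have hn : (0 : ℝ) < Fintype.card V := by exact_mod_cast Fintype.card_pos
  refine div_pos ?_ hn
  simp only [distMatrix_mul_adjMatrix_apply]
  obtain ⟨u, c, hc, hcl⟩ := SimpleGraph.exists_egirth_eq_length.2 (mt SimpleGraph.egirth_eq_top.2
    (by rw [hm]; exact ENat.natCast_ne_top _))
  have hlen : c.length = 2 * m + 1 := by
    rw [hm, Nat.cast_inj] at hcl; exact hcl.symm
  have hd : G.dist u (c.getVert m) = m := hc.dist_getVert hG hcl (by omega)
  have hd' : G.dist u (c.getVert (m + 1)) = m :=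
    hc.dist_getVert_of_le hG hcl (by omega) (by omega)
  have hpos : 0 < G.nbrsAtDist u (c.getVert m) m :=
    SimpleGraph.nbrsAtDist_pos_iff.2 ⟨_, c.adj_getVert_succ (by omega), hd'⟩
  have hnn (u v : V) : 0 ≤ (G.nbrsAtDist u v m : ℝ) * distMatrix G m u v := by
    simp only [distMatrix, Matrix.of_apply]
    split_ifs <;> simp
  refine Finset.sum_pos' (fun u _ => Finset.sum_nonneg fun v _ => hnn u v)
    ⟨u, Finset.mem_univ _, Finset.sum_pos' (fun v _ => hnn u v)
      ⟨c.getVert m, Finset.mem_univ _, ?_⟩⟩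
  simpa [distMatrix, hd] using hpos

end treePoly

/-! ### Coefficients of the predistance polynomials -/

section omega

variable [Nonempty V] {k : ℕ}

variable (G) in
/-- Each row, including the row of the minimal polynomial, is a nonzero multiple of a monic
polynomial orthogonal to all polynomials of lower degree. -/
lemma exists_monic_omega_eq {i : ℕ} (hi : i ≤ d G + 1) :
    ∃ q : ℝ[X], q.Monic ∧ q.degree = i ∧ (∀ f : ℝ[X], f.degree < i → scalar G f q = 0) ∧
      ∃ c : ℝ, c ≠ 0 ∧ ∀ j, omega G i j = c * q.coeff j := by
  rcases hi.lt_or_eq with h | rfl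
  · have h' : i ≤ d G := Nat.lt_succ_iff.1 h
    refine ⟨monicOrtho G i, monicOrtho_monic i, monicOrtho_degree i,
      fun f hf => monicOrtho_orth_lt h' hf, _,
      div_ne_zero (monicOrtho_eval_ne_zero h') (monicOrtho_norm_pos h').ne', fun j => ?_⟩
    rw [omega, if_pos h', predist, coeff_C_mul]
  · have hm : (minpoly ℝ (G.adjMatrix ℝ)).Monic :=
      minpoly.monic (Algebra.IsIntegral.isIntegral _)
    refine ⟨minpoly ℝ (G.adjMatrix ℝ), hm, ?_, fun f _ => ?_, 1, one_ne_zero, fun j => ?_⟩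
    · rw [degree_eq_natDegree hm.ne_zero, minpoly_natDegree]
    · rw [scalar, minpoly.aeval, mul_zero, Matrix.trace_zero, zero_div]
    · rw [omega, if_neg (by omega), one_mul]

lemma omega_eq_zero_of_odd (hG : G.Connected) (hreg : G.IsRegularOfDegree k) {i j : ℕ}
    (hid : i ≤ d G + 1) (hi : ((2 * i : ℕ) : ℕ∞) ≤ G.egirth) (hij : Odd (i + j)) :
    omega G i j = 0 := by
  obtain ⟨q, hq, hdeg, horth, c, -, hc⟩ := exists_monic_omega_eq G hid
  rw [hc, eq_treePoly hG hreg hid hi hq hdeg horth, treePoly_coeff_of_odd _ _ _ hij, mul_zero]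

lemma omega_self_eq_div (hG : G.Connected) (hreg : G.IsRegularOfDegree k) {i : ℕ}
    (hid : i ≤ d G) (hi : ((2 * i : ℕ) : ℕ∞) ≤ G.egirth) :
    0 < scalar G (treePoly k i) (treePoly k i) ∧ omega G i i =
      (treePoly k i).eval (k : ℝ) / scalar G (treePoly k i) (treePoly k i) := by
  have h : monicOrtho G i = treePoly k i :=
    eq_treePoly hG hreg (hid.trans (Nat.le_succ _)) hi (monicOrtho_monic i) (monicOrtho_degree i)
      fun f hf => monicOrtho_orth_lt hid hf
  refine ⟨h ▸ monicOrtho_norm_pos hid, ?_⟩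
  have hc : (treePoly k i).coeff i = 1 := by
    have := (treePoly_monic k i).coeff_natDegree
    rwa [treePoly_natDegree] at this
  rw [omega, if_pos hid, predist, h, coeff_C_mul, hc, mul_one, eigMax_eq hreg]

lemma omega_self_eq_one (hG : G.Connected) (hreg : G.IsRegularOfDegree k) {i : ℕ}
    (hid : i ≤ d G) (hi : ((2 * i : ℕ) : ℕ∞) < G.egirth) : omega G i i = 1 := by
  obtain ⟨hpos, h⟩ := omega_self_eq_div hG hreg hid hi.le
  rw [h, ← scalar_treePoly_self_eq hG hreg hi, div_self hpos.ne']

lemma omega_self_lt_one (hG : G.Connected) (hreg : G.IsRegularOfDegree k) {i : ℕ}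
    (hid : i ≤ d G) (hi : G.egirth = ((2 * i : ℕ) : ℕ∞)) : omega G i i < 1 := by
  obtain ⟨hpos, h⟩ := omega_self_eq_div hG hreg hid hi.ge
  rw [h, div_lt_one hpos]
  exact eval_treePoly_lt_scalar_self hG hreg hi

/-- If `q = x ^ (m + 1) + ⋯` had the parity of `m + 1`, then `q - x T_m` would have degree less
than `m` and be orthogonal to `T_m`. As `q` is orthogonal to `T_m`, so would be `x T_m`, against
`scalar_X_mul_treePoly_pos`. -/
lemma exists_omega_succ_ne_zero (hG : G.Connected) (hreg : G.IsRegularOfDegree k) {m : ℕ}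
    (hmd : m ≤ d G) (hm : G.egirth = ((2 * m + 1 : ℕ) : ℕ∞)) :
    ∃ j, Odd (m + 1 + j) ∧ omega G (m + 1) j ≠ 0 := by
  by_contra! hzero
  obtain ⟨q, hq, hdeg, horth, c, hc0, hc⟩ := exists_monic_omega_eq G (Nat.succ_le_succ hmd)
  have hnat : q.natDegree = m + 1 := natDegree_eq_of_degree_eq_some hdeg
  have hle : ((2 * m : ℕ) : ℕ∞) ≤ G.egirth := by rw [hm, Nat.cast_le]; omega
  have hlt : (q - treePoly k m * X).degree < (m : WithBot ℕ) := by
    rw [degree_lt_iff_coeff_zero]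
    intro j hj
    rcases hj.eq_or_lt with rfl | hj
    · have h1 : q.coeff m = 0 := by
        have := hzero m ⟨m, by ring⟩
        rw [Nat.succ_eq_add_one] at hc
        rw [hc] at this
        exact (mul_eq_zero.1 this).resolve_left hc0
      rw [coeff_sub, h1, ← pow_one X, coeff_mul_X_pow']
      split_ifs with h
      · rw [treePoly_coeff_of_odd, sub_zero]
        exact ⟨m - 1, by omega⟩
      · rw [sub_zero]
    · obtain ⟨j, rfl⟩ : ∃ l, j = l + 1 := ⟨j - 1, by omega⟩
      rw [coeff_sub, coeff_mul_X]
      rcases (Nat.lt_succ_iff.1 hj).eq_or_lt with rfl | hj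
      · have h1 := hq.coeff_natDegree
        have h2 := (treePoly_monic k m).coeff_natDegree
        rw [hnat] at h1
        rw [treePoly_natDegree] at h2
        rw [h1, h2, sub_self]
      · rw [coeff_eq_zero_of_natDegree_lt (by omega),
          coeff_eq_zero_of_natDegree_lt (by rw [treePoly_natDegree]; exact hj), sub_zero]
  have h1 := scalar_treePoly_eq_zero_of_degree_lt hG hreg hle hlt
  rw [scalar_sub_left, scalar_comm q,
    horth _ (by rw [treePoly_degree]; exact_mod_cast m.lt_succ_self)] at h1
  have := scalar_X_mul_treePoly_pos hG hreg hm
  linarith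

/-- Otherwise the minimal polynomial would be `T_{d+1}`, but `T_{d+1}(A)` is nonzero, since a
shortest cycle has two vertices at distance `d + 1`. -/
lemma le_d_of_le_egirth (hG : G.Connected) (hreg : G.IsRegularOfDegree k) {m : ℕ}
    (hm : ((2 * m : ℕ) : ℕ∞) ≤ G.egirth) (hfin : G.egirth ≠ ⊤) : m ≤ d G := by
  by_contra! hlt
  have hle : ((2 * (d G + 1) : ℕ) : ℕ∞) ≤ G.egirth := (Nat.cast_le.2 (by omega)).trans hm
  obtain ⟨u, c, hc, hcl⟩ := SimpleGraph.exists_egirth_eq_length.2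
    (mt SimpleGraph.egirth_eq_top.2 hfin)
  have hd : G.dist u (c.getVert (d G + 1)) = d G + 1 :=
    hc.dist_getVert hG hcl (by rw [hcl, Nat.cast_le] at hle; exact hle)
  have hmin : minpoly ℝ (G.adjMatrix ℝ) = treePoly k (d G + 1) := by
    have hmon : (minpoly ℝ (G.adjMatrix ℝ)).Monic :=
      minpoly.monic (Algebra.IsIntegral.isIntegral _)
    refine eq_treePoly hG hreg le_rfl hle hmon ?_ fun f _ => ?_
    · rw [degree_eq_natDegree hmon.ne_zero, minpoly_natDegree]
    · rw [scalar, minpoly.aeval, mul_zero, Matrix.trace_zero, zero_div]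
  have h0 := minpoly.aeval ℝ (G.adjMatrix ℝ)
  rw [hmin, aeval_treePoly hG hreg _ hle] at h0
  have hpos := branchMatrix_apply_pos hG hd
  rw [h0] at hpos
  exact lt_irrefl _ hpos

end omega

end Predistance

/-! ### Characterization of the girth -/

theorem proposition5p4 {V : Type*} [Fintype V] [DecidableEq V] (G : SimpleGraph V)
    [DecidableRel G.Adj] (hconn : G.Connected) (k : ℕ) (hreg : G.IsRegularOfDegree k) (m : ℕ) :
    (G.egirth = ((2 * m + 1 : ℕ) : ℕ∞) ↔
      m ≤ Predistance.d G ∧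
      (∀ i j : ℕ, i ≤ m → Odd (i + j) → Predistance.omega G i j = 0) ∧
      (∃ j : ℕ, Odd (m + 1 + j) ∧ Predistance.omega G (m + 1) j ≠ 0) ∧
      (∀ i : ℕ, 1 ≤ i → i ≤ m → Predistance.omega G i i = 1)) ∧
    (G.egirth = ((2 * m : ℕ) : ℕ∞) ↔
      m ≤ Predistance.d G ∧
      (∀ i j : ℕ, i ≤ m → Odd (i + j) → Predistance.omega G i j = 0) ∧
      (∀ i : ℕ, 1 ≤ i → i < m → Predistance.omega G i i = 1) ∧
      Predistance.omega G m m < 1) := by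
  have hne : Nonempty V := hconn.nonempty
  have three : ∀ g : ℕ, G.egirth = (g : ℕ∞) → 3 ≤ g := fun g hg => by
    have := SimpleGraph.three_le_egirth (G := G)
    rw [hg] at this
    exact_mod_cast this
  -- A girth `g < 2 * m` would already show in row `g / 2` or `g / 2 + 1`, both at most `m`.
  have lower : m ≤ Predistance.d G →
      (∀ i j : ℕ, i ≤ m → Odd (i + j) → Predistance.omega G i j = 0) →
      (∀ i : ℕ, 1 ≤ i → i < m → Predistance.omega G i i = 1) →
      ((2 * m : ℕ) : ℕ∞) ≤ G.egirth := by
    intro hmd hpar hone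
    by_contra! hlt
    obtain ⟨g, hg⟩ := ENat.ne_top_iff_exists.1 hlt.ne_top
    rw [← hg, Nat.cast_lt] at hlt
    have h3 := three g hg.symm
    rcases Nat.even_or_odd' g with ⟨r, rfl | rfl⟩
    · have h1 := Predistance.omega_self_lt_one hconn hreg (i := r) (by omega) hg.symm
      exact h1.ne (hone r (by omega) (by omega))
    · obtain ⟨j, hj, hj0⟩ :=
        Predistance.exists_omega_succ_ne_zero hconn hreg (m := r) (by omega) hg.symm
      exact hj0 (hpar _ j (by omega) hj)
  refine ⟨⟨fun hg => ?_, ?_⟩, ⟨fun hg => ?_, ?_⟩⟩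
  · have hlt : ((2 * m : ℕ) : ℕ∞) < G.egirth := by rw [hg, Nat.cast_lt]; omega
    have hmd : m ≤ Predistance.d G := Predistance.le_d_of_le_egirth hconn hreg hlt.le
      (by rw [hg]; exact ENat.natCast_ne_top _)
    refine ⟨hmd, fun i j hi hij => ?_,
      Predistance.exists_omega_succ_ne_zero hconn hreg hmd hg, fun i _ hi => ?_⟩
    · exact Predistance.omega_eq_zero_of_odd hconn hreg (by omega)
        ((Nat.cast_le.2 (by omega)).trans hlt.le) hij
    · exact Predistance.omega_self_eq_one hconn hreg (by omega)
        ((Nat.cast_le.2 (by omega)).trans_lt hlt)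
  · rintro ⟨hmd, hpar, ⟨j, hj, hj0⟩, hone⟩
    have hle := lower hmd hpar fun i h1 hi => hone i h1 hi.le
    by_contra hne
    rcases hle.eq_or_lt with heq | hlt
    · have h3 := three _ heq.symm
      have h1 := Predistance.omega_self_lt_one hconn hreg hmd heq.symm
      exact h1.ne (hone m (by omega) le_rfl)
    · have h1 : ((2 * m + 1 : ℕ) : ℕ∞) ≤ G.egirth := by
        rw [Nat.cast_add, Nat.cast_one]; exact Order.add_one_le_of_lt hlt
      have h2 : ((2 * (m + 1) : ℕ) : ℕ∞) ≤ G.egirth := by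
        rw [show 2 * (m + 1) = 2 * m + 1 + 1 by ring, Nat.cast_add, Nat.cast_one]
        exact Order.add_one_le_of_lt (lt_of_le_of_ne h1 (Ne.symm hne))
      exact hj0 (Predistance.omega_eq_zero_of_odd hconn hreg (by omega) h2 hj)
  · have hmd : m ≤ Predistance.d G := Predistance.le_d_of_le_egirth hconn hreg hg.ge
      (by rw [hg]; exact ENat.natCast_ne_top _)
    refine ⟨hmd, fun i j hi hij => ?_, fun i _ hi => ?_,
      Predistance.omega_self_lt_one hconn hreg hmd hg⟩
    · exact Predistance.omega_eq_zero_of_odd hconn hreg (by omega)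
        ((Nat.cast_le.2 (by omega)).trans hg.ge) hij
    · exact Predistance.omega_self_eq_one hconn hreg (by omega)
        (by rw [hg, Nat.cast_lt]; omega)
  · rintro ⟨hmd, hpar, hone, hlt⟩
    have hle := lower hmd hpar hone
    by_contra hne
    exact hlt.ne (Predistance.omega_self_eq_one hconn hreg hmd (lt_of_le_of_ne hle (Ne.symm hne)))

end
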